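/- A 2-colored Rogers–Ramanujan partition of $n\ge 0$ is a partition of $n$ into positive parts, each colored black or red, such that any two consecutive parts of the same color differ by at least $2$ and no integer occurs as a part in both colors (the empty partition of $0$ is allowed). Let $R(n)$ be the number of these partitions of $n$. For $j\in\{1,2\}$, let $r_j(m,n)$ be the number of those with exactly $m$ parts, all of them at least $j$, and let $R_j(x)=\sum_{m,n\ge 0} r_j(m,n)\,x^m q^n$. For complex $q$ with $|q|<1$, put $(a;q)_n=\prod_{i=0}^{n-1}(1-aq^i)$, $(a;q)_\infty=\lim_{n\to\infty}(a;q)_n$, $(a)_\infty=(a;q)_\infty$ and $(a_1,\dots,a_k;q)_\infty=(a_1;q)_\infty\cdots(a_k;q)_\infty$. **Theorem 1.2.** Let $q\in\mathbb C$ with $|q|<1$. Then $$\sum_{n\ge 0}R(n)\,q^n=\frac{(-q)_\infty\,(q^2,q^2,q^4;q^4)_\infty}{(q)_\infty},$$ where the series converges absolutely. Moreover, for $j\in\{1,2\}$ the series $R_j(x)$ converges absolutely for every $x\in\mathbb C$; for all $x\in\mathbb C$, $$R_1(x)-R_2(x)=xq\bigl(R_1(xq)+R_2(xq)\bigr),\qquad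 R_2(x)=R_1(xq);$$ and $$R_1(1)=\frac{(-q)_\infty\,(q^2,q^2,q^4;q^4)_\infty}{(q)_\infty}=\frac{(-q)_\infty}{(q)_\infty}\sum_{n\in\mathbb Z}(-1)^n q^{2n^2},$$ where the last series converges absolutely. -/

import Mathlib

open Filter Topology

/-- A 2-colored Rogers-Ramanujan partition. The parts of each color are listed in increasing order;
consecutive parts of the same color differ by at least two, and no integer occurs in both colors.
The empty partition is allowed. -/
@[ext]
structure TwoColoredRR where
  /-- the black parts, in increasing order -/
  black : List ℕ
  /-- the red parts, in increasing order -/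
  red : List ℕ
  black_pos : ∀ a ∈ black, 1 ≤ a
  red_pos : ∀ a ∈ red, 1 ≤ a
  black_gap : black.IsChain (fun a b => a + 2 ≤ b)
  red_gap : red.IsChain (fun a b => a + 2 ≤ b)
  disjoint : ∀ a ∈ black, a ∉ red

namespace TwoColoredRR

/-- All parts, of both colors. -/
def parts (π : TwoColoredRR) : List ℕ := π.black ++ π.red

/-- `π` is a partition of `π.size`. -/
def size (π : TwoColoredRR) : ℕ := π.parts.sum

/-- The number of parts of `π`. -/
def numParts (π : TwoColoredRR) : ℕ := π.parts.length

theorem finite_size_eq (n : ℕ) : {π : TwoColoredRR | π.size = n}.Finite := by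
  have key : ∀ l l' : List ℕ, l.IsChain (fun a b => a + 2 ≤ b) → l'.IsChain (fun a b => a + 2 ≤ b) →
      l.toFinset = l'.toFinset → l = l' := by
    intro l l' h h' e
    have s : l.SortedLT :=
      (List.isChain_iff_pairwise.mp (h.imp (fun a b hab => by omega : ∀ a b, a + 2 ≤ b → a < b))).sortedLT
    have s' : l'.SortedLT :=
      (List.isChain_iff_pairwise.mp (h'.imp (fun a b hab => by omega : ∀ a b, a + 2 ≤ b → a < b))).sortedLT
    have p : l.Perm l' := (List.perm_ext_iff_of_nodup s.nodup s'.nodup).mpr fun a => by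
      rw [← List.mem_toFinset, e, List.mem_toFinset]
    exact p.eq_of_pairwise (fun a b _ _ h1 h2 => absurd h1 (not_lt.mpr h2.le)) s.pairwise s'.pairwise
  refine Set.Finite.of_finite_image (f := fun π => (π.black.toFinset, π.red.toFinset)) ?_ ?_
  · refine (((Finset.range (n + 1)).powerset ×ˢ (Finset.range (n + 1)).powerset).finite_toSet).subset ?_
    rintro _ ⟨π, hπ, rfl⟩
    have hs : π.parts.sum = n := hπ
    simp only [Finset.coe_product, Set.mem_prod, Finset.mem_coe, Finset.mem_powerset]
    constructor <;> intro a ha <;> rw [List.mem_toFinset] at ha <;> rw [Finset.mem_range, ← hs] <;>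
      exact Nat.lt_succ_of_le (List.le_sum_of_mem (by simp [parts, ha]))
  · intro π _ π' _ h
    simp only [Prod.mk.injEq] at h
    exact TwoColoredRR.ext (key _ _ π.black_gap π'.black_gap h.1) (key _ _ π.red_gap π'.red_gap h.2)

/-- `R(n)`: the number of 2-colored Rogers-Ramanujan partitions of `n`. -/
noncomputable def count (n : ℕ) : ℕ := {π : TwoColoredRR | π.size = n}.ncard

/-- `r_j(m, n)`: the number of 2-colored Rogers-Ramanujan partitions of `n` with exactly `m` parts,
all of which are at least `j`. -/
noncomputable def countGE (j m n : ℕ) : ℕ :=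
  {π : TwoColoredRR | π.size = n ∧ π.numParts = m ∧ ∀ a ∈ π.parts, j ≤ a}.ncard

/-- `R_j(x) = ∑_{m, n ≥ 0} r_j(m, n) x ^ m q ^ n`. -/
noncomputable def genFun (j : ℕ) (q x : ℂ) : ℂ :=
  ∑' p : ℕ × ℕ, (countGE j p.1 p.2 : ℂ) * x ^ p.1 * q ^ p.2

end TwoColoredRR

/-- `(a; q)_n = ∏_{i = 0}^{n - 1} (1 - a q ^ i)`. -/
noncomputable def qPoch (a q : ℂ) (n : ℕ) : ℂ := ∏ i ∈ Finset.range n, (1 - a * q ^ i)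

/-- `(a; q)_∞ = lim_{n → ∞} (a; q)_n`, for `|q| < 1`. -/
noncomputable def qPochInf (a q : ℂ) : ℂ := limUnder atTop (qPoch a q)

/-- `(a₁, a₂, …, a_k; q)_∞ = (a₁; q)_∞ (a₂; q)_∞ ⋯ (a_k; q)_∞`. -/
noncomputable def qPochInfList (l : List ℂ) (q : ℂ) : ℂ := (l.map fun a => qPochInf a q).prod

theorem summable_norm_qPoch (a : ℂ) {q : ℂ} (hq : ‖q‖ < 1) :
    Summable fun i : ℕ => ‖-(a * q ^ i)‖ := by
  simpa [norm_mul, norm_pow] using (summable_geometric_of_lt_one (norm_nonneg q) hq).mul_left ‖a‖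

/-- The limit defining `(a; q)_∞` exists when `|q| < 1`. -/
theorem tendsto_qPoch (a : ℂ) {q : ℂ} (hq : ‖q‖ < 1) :
    Tendsto (qPoch a q) atTop (𝓝 (qPochInf a q)) := by
  have h := (multipliable_one_add_of_summable (summable_norm_qPoch a hq)).hasProd.tendsto_prod_nat
  have h' : Tendsto (qPoch a q) atTop (𝓝 (∏' i : ℕ, (1 + -(a * q ^ i)))) := by
    exact h.congr fun n => by simp only [qPoch, sub_eq_add_neg]
  exact tendsto_nhds_limUnder ⟨_, h'⟩

/-- `(q; q)_∞` does not vanish when `|q| < 1`. -/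
theorem qPochInf_self_ne_zero {q : ℂ} (hq : ‖q‖ < 1) : qPochInf q q ≠ 0 := by
  have h := (multipliable_one_add_of_summable (summable_norm_qPoch q hq)).hasProd.tendsto_prod_nat
  have h' : Tendsto (qPoch q q) atTop (𝓝 (∏' i : ℕ, (1 + -(q * q ^ i)))) := by
    exact h.congr fun n => by simp only [qPoch, sub_eq_add_neg]
  rw [tendsto_nhds_unique (tendsto_qPoch q hq) h']
  refine tprod_one_add_ne_zero_of_summable (fun i hi => ?_) (summable_norm_qPoch q hq)
  have e : q ^ (i + 1) = 1 := by rw [pow_succ']; linear_combination -hi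
  have : ‖q‖ ^ (i + 1) = 1 := by rw [← norm_pow, e, norm_one]
  exact absurd this (pow_lt_one₀ (norm_nonneg q) hq (Nat.succ_ne_zero i)).ne

/-! ### Weights and absolute convergence -/

namespace TwoColoredRR

/-! Everything is a sum of weights `x ^ m * q ^ n` over the type of partitions, so that set
bijections become functional equations. Adding 1 to every part replaces `x` by `x * q`. Classifying
by the colour of a part 1, and deleting it, gives the recurrence of `genFun_one_sub_two`.

The series F(x) = ∑ `lebesgueCoeff q 1 n * x ^ n` obeys the same second-order recurrence. Along `x =
q ^ k` both functions tend to 1, and `eq_zero_of_recurrence` says that this determines the solution;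
hence R₁(1) = F(1). Letting b vary in `lebesgueCoeff q b`, the step from b to b q² extracts a factor
1 + b q, so iterating from b = 1 gives F(1) = (-q; q²)_∞ (-q; q)_∞ (`tsum_lebesgueCoeff_one`).
Elementary product identities turn this into the stated quotient.

The theta series comes from Gauss's identity at `q ^ 2`. It is obtained as the limit of a finite
identity, `gaussProd_mul_sum`, whose induction step is a sum with a closed form. -/

theorem eq_of_toFinset_eq {l l' : List ℕ} (h : l.IsChain (fun a b => a + 2 ≤ b))
    (h' : l'.IsChain (fun a b => a + 2 ≤ b)) (e : l.toFinset = l'.toFinset) : l = l' := by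
  have s : l.SortedLT :=
    (List.isChain_iff_pairwise.mp (h.imp fun a b (hab : a + 2 ≤ b) => (by omega : a < b))).sortedLT
  have s' : l'.SortedLT :=
    (List.isChain_iff_pairwise.mp (h'.imp fun a b (hab : a + 2 ≤ b) => (by omega : a < b))).sortedLT
  have p : l.Perm l' := (List.perm_ext_iff_of_nodup s.nodup s'.nodup).mpr fun a => by
    rw [← List.mem_toFinset, e, List.mem_toFinset]
  exact p.eq_of_pairwise (fun a b _ _ h1 h2 => absurd h1 (not_lt.mpr h2.le)) s.pairwise s'.pairwise

theorem nodup_of_gap {l : List ℕ} (h : l.IsChain (fun a b => a + 2 ≤ b)) : l.Nodup :=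
  (List.isChain_iff_pairwise.mp (h.imp fun a b (hab : a + 2 ≤ b) =>
    (by omega : a < b))).sortedLT.nodup

/-- The weight `x ^ m q ^ n` of a partition of `n` into `m` parts. -/
noncomputable def weight (q x : ℂ) (π : TwoColoredRR) : ℂ := x ^ π.numParts * q ^ π.size

theorem prod_map_mul_pow (q x : ℂ) (l : List ℕ) :
    (l.map fun a => x * q ^ a).prod = x ^ l.length * q ^ l.sum := by
  induction l with
  | nil => simp
  | cons a l ih => simp only [List.map_cons, List.prod_cons, ih, List.length_cons, List.sum_cons]; ring

theorem weight_eq_prod (q x : ℂ) (π : TwoColoredRR) :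
    weight q x π = (∏ a ∈ π.black.toFinset, x * q ^ a) * ∏ a ∈ π.red.toFinset, x * q ^ a := by
  rw [List.prod_toFinset _ (nodup_of_gap π.black_gap), List.prod_toFinset _ (nodup_of_gap π.red_gap),
    prod_map_mul_pow, prod_map_mul_pow, weight, numParts, size, parts, List.length_append,
    List.sum_append]
  ring

/-- A partition is determined by its pair of sets of parts, so the norms form a subfamily of the
expansion of the square of ∏ (1 + |x| |q|^i), which converges. -/
theorem summable_norm_weight {q : ℂ} (hq : ‖q‖ < 1) (x : ℂ) :
    Summable fun π => ‖weight q x π‖ := by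
  have hs : Summable fun i : ℕ => ‖x‖ * ‖q‖ ^ i :=
    (summable_geometric_of_lt_one (norm_nonneg q) hq).mul_left _
  have hS : Summable fun S : Finset ℕ => ∏ i ∈ S, (‖x‖ * ‖q‖ ^ i) :=
    summable_finsetProd_of_summable_nonneg (fun i => by positivity) hs
  have hP := hS.mul_of_nonneg hS (fun S => Finset.prod_nonneg fun i _ => by positivity)
    (fun S => Finset.prod_nonneg fun i _ => by positivity)
  have inj : Function.Injective fun π : TwoColoredRR => (π.black.toFinset, π.red.toFinset) := by
    intro π π' h
    simp only [Prod.mk.injEq] at h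
    exact TwoColoredRR.ext (eq_of_toFinset_eq π.black_gap π'.black_gap h.1)
      (eq_of_toFinset_eq π.red_gap π'.red_gap h.2)
  refine (hP.comp_injective inj).congr fun π => ?_
  simp [weight_eq_prod, norm_prod]

theorem summable_weight {q : ℂ} (hq : ‖q‖ < 1) (x : ℂ) : Summable (weight q x) :=
  (summable_norm_weight hq x).of_norm

/-- Counting a convergent sum along the finite fibers of a map. -/
theorem _root_.hasSum_ncard_mul {α β : Type*} (g : α → β) (S : Set α) (h : β → ℂ)
    (hfin : ∀ b, {a | g a = b}.Finite) (hs : Summable fun a => h (g a)) :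
    HasSum (fun b => (({a | g a = b ∧ a ∈ S} : Set α).ncard : ℂ) * h b) (∑' a : S, h (g a)) := by
  have h1 : HasSum (fun a : S => h (g a)) (∑' a : S, h (g a)) := (hs.subtype S).hasSum
  rw [← (Equiv.sigmaFiberEquiv fun a : S => g a).hasSum_iff] at h1
  refine h1.sigma fun b => ?_
  let e : {a : S // g a = b} ≃ ({a | g a = b ∧ a ∈ S} : Set α) :=
    { toFun := fun a => ⟨a.1.1, a.2, a.1.2⟩
      invFun := fun a => ⟨⟨a.1, a.2.2⟩, a.2.1⟩
      left_inv := fun _ => rfl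
      right_inv := fun _ => rfl }
  have hf : ({a | g a = b ∧ a ∈ S} : Set α).Finite := (hfin b).subset fun a ha => ha.1
  have : Finite ({a | g a = b ∧ a ∈ S} : Set α) := hf
  have : Finite {a : S // g a = b} := Finite.of_equiv _ e.symm
  have := Fintype.ofFinite {a : S // g a = b}
  have hc : (({a | g a = b ∧ a ∈ S} : Set α).ncard : ℂ) * h b =
      ∑ a : {a : S // g a = b}, h (g a.1) := by
    rw [Finset.sum_congr rfl fun a _ => by rw [a.2], Finset.sum_const, nsmul_eq_mul,
      Finset.card_univ, ← Nat.card_eq_fintype_card, Nat.card_congr e, Nat.card_coe_set_eq]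
  rw [hc]
  exact hasSum_fintype _

/-- The partitions with all parts at least `j`. -/
def partsGE (j : ℕ) : Set TwoColoredRR := {π | ∀ a ∈ π.parts, j ≤ a}

theorem hasSum_countGE {q : ℂ} (hq : ‖q‖ < 1) (j : ℕ) (x : ℂ) :
    HasSum (fun p : ℕ × ℕ => (countGE j p.1 p.2 : ℂ) * x ^ p.1 * q ^ p.2)
      (∑' π : partsGE j, weight q x π) := by
  have := hasSum_ncard_mul (fun π : TwoColoredRR => (π.numParts, π.size)) (partsGE j)
    (fun p => x ^ p.1 * q ^ p.2)
    -- The size alone already bounds the fiber; the number of parts is not needed.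
    (fun b => (finite_size_eq b.2).subset fun π (hπ : (_, _) = b) => by simp [← hπ])
    (summable_weight hq x)
  convert this using 2 with p
  · rw [mul_assoc, countGE]
    congr 3
    ext π
    simp only [partsGE, Set.mem_ofPred_eq, Prod.ext_iff]
    tauto
  · rfl

theorem partsGE_one : partsGE 1 = Set.univ := by
  ext π
  simp only [partsGE, parts, List.mem_append, Set.mem_ofPred_eq, Set.mem_univ, iff_true]
  rintro a (h | h)
  exacts [π.black_pos a h, π.red_pos a h]

theorem genFun_eq {q : ℂ} (hq : ‖q‖ < 1) (j : ℕ) (x : ℂ) :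
    genFun j q x = ∑' π : partsGE j, weight q x π :=
  (hasSum_countGE hq j x).tsum_eq

theorem genFun_one_eq {q : ℂ} (hq : ‖q‖ < 1) (x : ℂ) : genFun 1 q x = ∑' π, weight q x π := by
  rw [genFun_eq hq, partsGE_one, tsum_univ]

theorem hasSum_count {q : ℂ} (hq : ‖q‖ < 1) :
    HasSum (fun n : ℕ => (count n : ℂ) * q ^ n) (genFun 1 q 1) := by
  have := hasSum_ncard_mul size Set.univ (fun n => q ^ n) finite_size_eq
    ((summable_weight hq 1).congr fun π => by simp [weight])
  rw [tsum_univ (f := fun π => q ^ size π)] at this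
  simpa [genFun_one_eq hq, weight, count] using this

/-! ### Bijections and the functional equations -/

/-- Adding one to every part. -/
def shift (π : TwoColoredRR) : TwoColoredRR where
  black := π.black.map (· + 1)
  red := π.red.map (· + 1)
  black_pos := by simp
  red_pos := by simp
  black_gap := by
    rw [List.isChain_map]; exact π.black_gap.imp fun a b (h : a + 2 ≤ b) => by omega
  red_gap := by
    rw [List.isChain_map]; exact π.red_gap.imp fun a b (h : a + 2 ≤ b) => by omega
  disjoint := by
    simp only [List.mem_map, forall_exists_index, and_imp, not_exists, not_and]
    rintro _ a ha rfl b hb e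
    exact π.disjoint a ha (by rwa [← Nat.succ_injective e])

theorem parts_shift (π : TwoColoredRR) : π.shift.parts = π.parts.map (· + 1) := by
  simp [parts, shift]

theorem shift_injective : Function.Injective shift := by
  intro π π' h
  have h1 := congrArg black h
  have h2 := congrArg red h
  have inj := List.map_injective_iff.mpr (Nat.succ_injective)
  exact TwoColoredRR.ext (inj h1) (inj h2)

theorem exists_shift_eq {π : TwoColoredRR} (h : π ∈ partsGE 2) : ∃ π', shift π' = π := by
  have hb : ∀ a ∈ π.black, 2 ≤ a := fun a ha => h a (by simp [parts, ha])
  have hr : ∀ a ∈ π.red, 2 ≤ a := fun a ha => h a (by simp [parts, ha])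
  have hm : ∀ l : List ℕ, (∀ a ∈ l, 2 ≤ a) → (l.map (· - 1)).map (· + 1) = l := by
    intro l hl
    rw [List.map_map]
    conv_rhs => rw [← List.map_id l]
    exact List.map_congr_left fun a ha => by have := hl a ha; simp; omega
  have hg : ∀ l : List ℕ, (∀ a ∈ l, 2 ≤ a) → l.IsChain (fun a b => a + 2 ≤ b) →
      (l.map (· - 1)).IsChain (fun a b => a + 2 ≤ b) := by
    intro l hl hc
    rw [← hm l hl, List.isChain_map] at hc
    exact hc.imp fun a b (h : a + 1 + 2 ≤ b + 1) => by omega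
  refine ⟨⟨π.black.map (· - 1), π.red.map (· - 1), ?_, ?_, hg _ hb π.black_gap, hg _ hr π.red_gap,
    ?_⟩, ?_⟩
  · simp only [List.mem_map, forall_exists_index, and_imp]
    rintro _ a ha rfl
    have := hb a ha; omega
  · simp only [List.mem_map, forall_exists_index, and_imp]
    rintro _ a ha rfl
    have := hr a ha; omega
  · simp only [List.mem_map, forall_exists_index, and_imp, not_exists, not_and]
    rintro _ a ha rfl b hb' e
    have := hb a ha
    have := hr b hb'
    obtain rfl : b = a := by omega
    exact π.disjoint b ha hb'
  · exact TwoColoredRR.ext (hm _ hb) (hm _ hr)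

theorem shift_image_partsGE {j : ℕ} (hj : 1 ≤ j) : shift '' partsGE j = partsGE (j + 1) := by
  ext π
  constructor
  · rintro ⟨π, h, rfl⟩ a ha
    rw [parts_shift, List.mem_map] at ha
    obtain ⟨b, hb, rfl⟩ := ha
    have := h b hb
    simpa
  · intro h
    obtain ⟨π', rfl⟩ := exists_shift_eq (π := π) fun a ha => (by omega : 2 ≤ j + 1).trans (h a ha)
    refine ⟨π', fun a ha => ?_, rfl⟩
    have := h (a + 1) (by rw [parts_shift]; exact List.mem_map_of_mem ha)
    omega

theorem weight_shift (q x : ℂ) (π : TwoColoredRR) : weight q x π.shift = weight q (x * q) π := by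
  have : ∀ l : List ℕ, (l.map (· + 1)).sum = l.sum + l.length := by
    intro l
    induction l with
    | nil => simp
    | cons a l ih => simp only [List.map_cons, List.sum_cons, ih, List.length_cons]; omega
  simp only [weight, numParts, size, parts_shift, List.length_map, this]
  ring

theorem tsum_partsGE_succ (q x : ℂ) {j : ℕ} (hj : 1 ≤ j) :
    ∑' π : partsGE (j + 1), weight q x π = ∑' π : partsGE j, weight q (x * q) π := by
  rw [← shift_image_partsGE hj, tsum_image (weight q x) shift_injective.injOn]
  simp only [weight_shift]

/-- Exchanging the colors. -/
def swap (π : TwoColoredRR) : TwoColoredRR where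
  black := π.red
  red := π.black
  black_pos := π.red_pos
  red_pos := π.black_pos
  black_gap := π.red_gap
  red_gap := π.black_gap
  disjoint := fun a h h' => π.disjoint a h' h

theorem swap_swap (π : TwoColoredRR) : π.swap.swap = π := rfl

theorem mem_parts_swap (π : TwoColoredRR) (a : ℕ) : a ∈ π.swap.parts ↔ a ∈ π.parts := by
  simp [parts, swap, or_comm]

theorem weight_swap (q x : ℂ) (π : TwoColoredRR) : weight q x π.swap = weight q x π := by
  simp only [weight, numParts, size, parts, swap, List.length_append, List.sum_append]
  rw [Nat.add_comm π.red.length, Nat.add_comm π.red.sum]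

theorem tsum_red_eq_black (q x : ℂ) (j : ℕ) :
    ∑' π : ↥(partsGE j ∩ {π | j ∈ π.red}), weight q x π =
      ∑' π : ↥(partsGE j ∩ {π | j ∈ π.black}), weight q x π := by
  have : partsGE j ∩ {π | j ∈ π.red} = swap '' (partsGE j ∩ {π | j ∈ π.black}) := by
    ext π
    constructor
    · rintro ⟨h, h'⟩
      exact ⟨π.swap, ⟨fun a ha => h a ((mem_parts_swap π a).mp ha), h'⟩, rfl⟩
    · rintro ⟨π, ⟨h, h'⟩, rfl⟩
      exact ⟨fun a ha => h a ((mem_parts_swap π a).mp ha), h'⟩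
  rw [this, tsum_image (weight q x) (Function.LeftInverse.injective swap_swap).injOn]
  simp only [weight_swap]

theorem compl_black_eq (j : ℕ) : partsGE j ∩ {π | j ∉ π.black} =
    partsGE (j + 1) ∪ (partsGE j ∩ {π | j ∈ π.red}) := by
  ext π
  simp only [partsGE, parts, List.mem_append, Set.mem_inter_iff, Set.mem_ofPred_eq, Set.mem_union]
  constructor
  · rintro ⟨h, h'⟩
    by_cases hr : j ∈ π.red
    · exact Or.inr ⟨h, hr⟩
    · refine Or.inl fun a ha => Nat.lt_of_le_of_ne (h a ha) ?_
      rintro rfl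
      tauto
  · rintro (h | ⟨h, h'⟩)
    · exact ⟨fun a ha => (Nat.le_succ j).trans (h a ha), fun hb => by
        have := h j (Or.inl hb); omega⟩
    · exact ⟨h, fun hb => π.disjoint j hb h'⟩

theorem tsum_compl_black {q : ℂ} (hq : ‖q‖ < 1) (x : ℂ) (j : ℕ) :
    ∑' π : ↥(partsGE j ∩ {π | j ∉ π.black}), weight q x π =
      ∑' π : partsGE (j + 1), weight q x π +
        ∑' π : ↥(partsGE j ∩ {π | j ∈ π.black}), weight q x π := by
  have hs := summable_weight hq x
  rw [compl_black_eq, ← tsum_red_eq_black, Summable.tsum_union_disjoint _ (hs.subtype _) (hs.subtype _)]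
  rw [Set.disjoint_left]
  rintro π h ⟨-, h'⟩
  have := h j (List.mem_append_right _ h')
  omega

/-- The part `j` is absent, black or red, exclusively; exchanging colours equates the last two
cases, hence the factor 2. -/
theorem tsum_partsGE_split {q : ℂ} (hq : ‖q‖ < 1) (x : ℂ) (j : ℕ) :
    ∑' π : partsGE j, weight q x π = ∑' π : partsGE (j + 1), weight q x π +
        2 * ∑' π : ↥(partsGE j ∩ {π | j ∈ π.black}), weight q x π := by
  have hs := summable_weight hq x
  have : partsGE j = (partsGE j ∩ {π | j ∉ π.black}) ∪ (partsGE j ∩ {π | j ∈ π.black}) := by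
    ext π; simp only [Set.mem_union, Set.mem_inter_iff, Set.mem_ofPred_eq]; tauto
  conv_lhs => rw [this]
  rw [Summable.tsum_union_disjoint _ (hs.subtype _) (hs.subtype _), tsum_compl_black hq]
  · ring
  · rw [Set.disjoint_left]
    rintro π ⟨-, h⟩ ⟨-, h'⟩
    exact h h'

theorem isChain_one_cons {l : List ℕ} (h : l.IsChain fun a b => a + 2 ≤ b)
    (hl : ∀ a ∈ l, 3 ≤ a) : (1 :: l).IsChain fun a b => a + 2 ≤ b := by
  cases l with
  | nil => simp
  | cons b l => exact List.IsChain.cons_cons (hl b (by simp)) h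

theorem three_le_of_mem {π : TwoColoredRR} (h : π ∈ partsGE 2 ∩ {π | 2 ∉ π.black}) {a : ℕ}
    (ha : a ∈ π.black) : 3 ≤ a :=
  Nat.lt_of_le_of_ne (h.1 a (List.mem_append_left _ ha)) (by rintro rfl; exact h.2 ha)

/-- Inserting a black part `1`. -/
def insertOne (π : ↥(partsGE 2 ∩ {π | 2 ∉ π.black})) : TwoColoredRR where
  black := 1 :: π.1.black
  red := π.1.red
  black_pos := by
    simp only [List.mem_cons, forall_eq_or_imp, le_refl, true_and]; exact π.1.black_pos
  red_pos := π.1.red_pos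
  black_gap := isChain_one_cons π.1.black_gap fun _ => three_le_of_mem π.2
  red_gap := π.1.red_gap
  disjoint := by
    simp only [List.mem_cons, forall_eq_or_imp]
    refine ⟨fun h => ?_, π.1.disjoint⟩
    have := π.2.1 1 (List.mem_append_right _ h)
    omega

theorem insertOne_injective : Function.Injective insertOne := by
  intro π π' h
  have h1 := congrArg black h
  have h2 := congrArg red h
  exact Subtype.ext (TwoColoredRR.ext (List.cons_injective h1) h2)

theorem range_insertOne : Set.range insertOne = partsGE 1 ∩ {π | 1 ∈ π.black} := by
  rw [partsGE_one, Set.univ_inter]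
  ext π
  constructor
  · rintro ⟨π, rfl⟩
    simp [insertOne]
  · rcases π with ⟨b, r, hb, hr, gb, gr, d⟩
    intro h
    change 1 ∈ b at h
    cases b with
    | nil => simp at h
    | cons c l =>
      -- The gap relation is transitive, so it holds between all pairs. This forces the black 1 to
      -- be the head and every other black part to be at least 3.
      have hpw : (c :: l).Pairwise fun a b => a + 2 ≤ b := by
        have : IsTrans ℕ fun a b => a + 2 ≤ b := ⟨fun a b c h h' => by omega⟩
        exact List.isChain_iff_pairwise.mp gb
      rw [List.pairwise_cons] at hpw
      have hc : c = 1 := by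
        rcases List.mem_cons.mp h with h | h
        · exact h.symm
        · have := hpw.1 1 h; omega
      subst hc
      refine ⟨⟨⟨l, r, fun a ha => hb a (by simp [ha]), hr, gb.tail, gr,
        fun a ha => d a (by simp [ha])⟩, ?_, ?_⟩, rfl⟩
      · intro a ha
        rcases List.mem_append.mp ha with ha | ha
        · have := hpw.1 a ha; omega
        · have h1 := hr a ha
          have : a ≠ 1 := by rintro rfl; exact d 1 (by simp) ha
          omega
      · intro h2
        have := hpw.1 2 h2; omega

/-- Deleting a black 1 leaves black parts at least 3 and red parts at least 2, since red 1 is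
excluded by disjointness but red 2 is allowed. -/
theorem tsum_one_mem_black (q x : ℂ) :
    ∑' π : ↥(partsGE 1 ∩ {π | 1 ∈ π.black}), weight q x π =
      x * q * ∑' π : ↥(partsGE 2 ∩ {π | 2 ∉ π.black}), weight q x π := by
  rw [← range_insertOne, tsum_range (weight q x) insertOne_injective, ← tsum_mul_left]
  refine tsum_congr fun π => ?_
  simp only [weight, numParts, size, parts, insertOne, List.cons_append, List.length_cons,
    List.sum_cons]
  ring

theorem genFun_two_eq {q : ℂ} (hq : ‖q‖ < 1) (x : ℂ) : genFun 2 q x = genFun 1 q (x * q) := by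
  rw [genFun_eq hq, genFun_eq hq, tsum_partsGE_succ q x le_rfl]

/-- Let B be the sum over partitions with parts at least 2 and a black 2, and R₃ the one with parts
at least 3. The left side is 2xq(R₃ + B), while R₂ = R₃ + 2B, so it equals xq(R₂ + R₃); the shift
finishes. -/
theorem genFun_one_sub_two {q : ℂ} (hq : ‖q‖ < 1) (x : ℂ) :
    genFun 1 q x - genFun 2 q x = x * q * (genFun 1 q (x * q) + genFun 2 q (x * q)) := by
  simp only [genFun_eq hq, ← tsum_partsGE_succ q x le_rfl, ← tsum_partsGE_succ q x one_le_two]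
  rw [tsum_partsGE_split hq x 1, tsum_one_mem_black, tsum_compl_black hq]
  rw [tsum_partsGE_split hq x 2]
  ring

/-- The empty partition. -/
def empty : TwoColoredRR where
  black := []
  red := []
  black_pos := by simp
  red_pos := by simp
  black_gap := by simp
  red_gap := by simp
  disjoint := by simp

theorem weight_zero (q : ℂ) (π : TwoColoredRR) (h : π ≠ empty) : weight q 0 π = 0 := by
  have : π.numParts ≠ 0 := fun h0 => h <| by
    simp only [numParts, parts, List.length_eq_zero_iff, List.append_eq_nil_iff] at h0
    exact TwoColoredRR.ext h0.1 h0.2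
  simp [weight, this]

/-- This is the initial condition at `x = 0`, where only the empty partition survives; the weights
at `x = 1` dominate. -/
theorem tendsto_genFun_pow {q : ℂ} (hq : ‖q‖ < 1) :
    Tendsto (fun k : ℕ => genFun 1 q (q ^ k)) atTop (𝓝 1) := by
  have h0 : ∑' π, weight q 0 π = 1 := by
    rw [tsum_eq_single empty (weight_zero q)]
    simp [weight, numParts, size, parts, empty]
  simp only [genFun_one_eq hq]
  rw [← h0]
  refine tendsto_tsum_of_dominated_convergence (summable_norm_weight hq 1) (fun π => ?_)
    (Eventually.of_forall fun k π => ?_)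
  · exact ((tendsto_pow_atTop_nhds_zero_of_norm_lt_one hq).pow _).mul_const _
  · simp only [weight, norm_mul, norm_pow, norm_one, one_pow]
    gcongr
    exact pow_le_one₀ (by positivity) (pow_le_one₀ (norm_nonneg q) hq.le)

end TwoColoredRR

/-! ### Lebesgue's series and its functional equations -/

theorem one_sub_pow_ne_zero {q : ℂ} (hq : ‖q‖ < 1) (n : ℕ) : 1 - q ^ (n + 1) ≠ 0 := by
  intro h
  have : ‖q‖ ^ (n + 1) = 1 := by rw [← norm_pow, ← sub_eq_zero.mp h, norm_one]
  exact (pow_lt_one₀ (norm_nonneg q) hq n.succ_ne_zero).ne this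

theorem one_add_pow_ne_zero {q : ℂ} (hq : ‖q‖ < 1) (n : ℕ) : 1 + q ^ (n + 1) ≠ 0 := by
  intro h
  have : ‖q‖ ^ (n + 1) = 1 := by
    rw [← norm_pow, eq_neg_of_add_eq_zero_right h, norm_neg, norm_one]
  exact (pow_lt_one₀ (norm_nonneg q) hq n.succ_ne_zero).ne this

/-- `q ^ (n (n + 1) / 2) (-b; q)_n / (q; q)_n`. -/
noncomputable def lebesgueCoeff (q b : ℂ) (n : ℕ) : ℂ :=
  ∏ i ∈ Finset.range n, q ^ (i + 1) * (1 + b * q ^ i) / (1 - q ^ (i + 1))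

/-- A bound for `lebesgueCoeff q b n` that is uniform in `‖b‖ ≤ 1`. -/
noncomputable def lebesgueBound (q : ℂ) (n : ℕ) : ℝ :=
  ∏ i ∈ Finset.range n, ‖q‖ ^ (i + 1) * 2 / ‖1 - q ^ (i + 1)‖

section
variable {q : ℂ} (hq : ‖q‖ < 1)
include hq

theorem norm_lebesgueCoeff_le {b : ℂ} (hb : ‖b‖ ≤ 1) (n : ℕ) :
    ‖lebesgueCoeff q b n‖ ≤ lebesgueBound q n := by
  rw [lebesgueCoeff, lebesgueBound, norm_prod]
  refine Finset.prod_le_prod (fun i _ => norm_nonneg _) fun i _ => ?_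
  rw [norm_div, norm_mul, norm_pow]
  gcongr
  calc ‖1 + b * q ^ i‖ ≤ ‖(1 : ℂ)‖ + ‖b * q ^ i‖ := norm_add_le _ _
    _ ≤ 1 + 1 * 1 := by
      rw [norm_mul, norm_pow, norm_one]
      gcongr
      exact pow_le_one₀ (norm_nonneg q) hq.le
    _ = 2 := by norm_num

theorem summable_lebesgueBound : Summable (lebesgueBound q) := by
  have hp : Tendsto (fun n : ℕ => q ^ (n + 1)) atTop (𝓝 0) :=
    (tendsto_pow_atTop_nhds_zero_of_norm_lt_one hq).comp (tendsto_add_atTop_nat 1)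
  have ht : Tendsto (fun n : ℕ => ‖q‖ ^ (n + 1) * 2 / ‖1 - q ^ (n + 1)‖) atTop (𝓝 0) := by
    have h1 : Tendsto (fun n : ℕ => ‖q ^ (n + 1)‖ * 2 / ‖1 - q ^ (n + 1)‖) atTop
        (𝓝 (‖(0 : ℂ)‖ * 2 / ‖(1 : ℂ) - 0‖)) :=
      (hp.norm.mul_const 2).div (tendsto_const_nhds.sub hp).norm (by simp)
    simpa [norm_pow] using h1
  refine summable_of_ratio_norm_eventually_le (r := 1 / 2) (by norm_num) ?_
  filter_upwards [ht.eventually_le_const (show (0 : ℝ) < 1 / 2 by norm_num)] with n hn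
  rw [lebesgueBound, Finset.prod_range_succ, ← lebesgueBound, norm_mul, mul_comm]
  gcongr
  rwa [Real.norm_of_nonneg (by positivity)]

theorem summable_lebesgueCoeff_mul {b x : ℂ} (hb : ‖b‖ ≤ 1) (hx : ‖x‖ ≤ 1) :
    Summable fun n => lebesgueCoeff q b n * x ^ n :=
  Summable.of_norm_bounded (summable_lebesgueBound hq) fun n => by
    rw [norm_mul, norm_pow]
    exact (mul_le_of_le_one_right (norm_nonneg _) (pow_le_one₀ (norm_nonneg x) hx)).trans
      (norm_lebesgueCoeff_le hq hb n)

theorem summable_lebesgueCoeff {b : ℂ} (hb : ‖b‖ ≤ 1) : Summable (lebesgueCoeff q b) := by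
  simpa using summable_lebesgueCoeff_mul hq hb (x := 1) (by simp)

theorem lebesgueCoeff_succ (b : ℂ) (n : ℕ) :
    lebesgueCoeff q b (n + 1) * (1 - q ^ (n + 1)) =
      q ^ (n + 1) * (1 + b * q ^ n) * lebesgueCoeff q b n := by
  rw [lebesgueCoeff, Finset.prod_range_succ, ← lebesgueCoeff]
  have := one_sub_pow_ne_zero hq n
  field_simp

/-- Both sides contain (-b; q)_{n+1}, with its last or its first factor split off. -/
theorem lebesgueCoeff_mul_q (b : ℂ) (n : ℕ) :
    lebesgueCoeff q b n * (1 + b * q ^ n) = (1 + b) * lebesgueCoeff q (b * q) n := by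
  induction n with
  | zero => simp [lebesgueCoeff]
  | succ n ih =>
    have h := one_sub_pow_ne_zero hq n
    refine mul_right_cancel₀ h ?_
    linear_combination (1 + b * q ^ (n + 1)) * lebesgueCoeff_succ hq b n -
      (1 + b) * lebesgueCoeff_succ hq (b * q) n + q ^ (n + 1) * (1 + b * q ^ (n + 1)) * ih

theorem lebesgueCoeff_succ_sub (b : ℂ) (n : ℕ) :
    lebesgueCoeff q b (n + 1) - lebesgueCoeff q (b * q) (n + 1) =
      b * q * (lebesgueCoeff q (b * q) n * q ^ n) := by
  refine mul_right_cancel₀ (one_sub_pow_ne_zero hq n) ?_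
  linear_combination lebesgueCoeff_succ hq b n - lebesgueCoeff_succ hq (b * q) n +
    q ^ (n + 1) * lebesgueCoeff_mul_q hq b n

/-- This is the coefficient recurrence `lebesgueCoeff_succ` summed against `x ^ (n + 1)`. At `b = 1`
it is the recurrence of R₁. -/
theorem tsum_lebesgueCoeff_mul_sub {b x : ℂ} (hb : ‖b‖ ≤ 1) (hx : ‖x‖ ≤ 1) :
    ∑' n, lebesgueCoeff q b n * x ^ n - ∑' n, lebesgueCoeff q b n * (x * q) ^ n =
      x * q * (∑' n, lebesgueCoeff q b n * (x * q) ^ n +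
        b * ∑' n, lebesgueCoeff q b n * (x * q * q) ^ n) := by
  have hxq : ‖x * q‖ ≤ 1 := by
    rw [norm_mul]; exact mul_le_one₀ hx (norm_nonneg q) hq.le
  have hxqq : ‖x * q * q‖ ≤ 1 := by
    rw [norm_mul]; exact mul_le_one₀ hxq (norm_nonneg q) hq.le
  have s1 := summable_lebesgueCoeff_mul hq hb hx
  have s2 := summable_lebesgueCoeff_mul hq hb hxq
  have s3 := summable_lebesgueCoeff_mul hq hb hxqq
  rw [← s1.tsum_sub s2, (s1.sub s2).tsum_eq_zero_add, ← tsum_mul_left,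
    ← s2.tsum_add (s3.mul_left b), ← tsum_mul_left]
  simp only [pow_zero, mul_one, sub_self, zero_add]
  refine tsum_congr fun n => ?_
  simp only [mul_pow]
  linear_combination x ^ (n + 1) * lebesgueCoeff_succ hq b n

/-- Passing from b to b q adds a multiple of the series at `x = q`; `lebesgueCoeff_mul_q` absorbs
that series into the one at b q². -/
theorem tsum_lebesgueCoeff_eq {b : ℂ} (hb : ‖b‖ ≤ 1) :
    ∑' n, lebesgueCoeff q b n =
      (1 + b * q) * ∑' n, lebesgueCoeff q (b * q * q) n := by
  have hbq : ‖b * q‖ ≤ 1 := by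
    rw [norm_mul]; exact mul_le_one₀ hb (norm_nonneg q) hq.le
  have s1 := summable_lebesgueCoeff hq hb
  have s2 := summable_lebesgueCoeff hq hbq
  have s3 := summable_lebesgueCoeff_mul hq hbq hq.le
  have h1 : ∑' n, lebesgueCoeff q b n - ∑' n, lebesgueCoeff q (b * q) n =
      b * q * ∑' n, lebesgueCoeff q (b * q) n * q ^ n := by
    rw [← s1.tsum_sub s2, (s1.sub s2).tsum_eq_zero_add, ← tsum_mul_left]
    simp only [lebesgueCoeff_succ_sub hq]
    simp [lebesgueCoeff]
  have h2 : ∑' n, lebesgueCoeff q (b * q) n + b * q * ∑' n, lebesgueCoeff q (b * q) n * q ^ n =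
      (1 + b * q) * ∑' n, lebesgueCoeff q (b * q * q) n := by
    rw [← tsum_mul_left, ← tsum_mul_left, ← s2.tsum_add (s3.mul_left _)]
    refine tsum_congr fun n => ?_
    linear_combination lebesgueCoeff_mul_q hq (b * q) n
  linear_combination h1 + h2

end

/-! ### Solving the recurrences by iteration -/

theorem eq_mul_of_tendsto {f c : ℕ → ℂ} {l p : ℂ} (h : ∀ k, f k = c k * f (k + 1))
    (hf : Tendsto f atTop (𝓝 l))
    (hc : Tendsto (fun n => ∏ i ∈ Finset.range n, c i) atTop (𝓝 p)) : f 0 = p * l := by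
  have h0 : ∀ n, f 0 = (∏ i ∈ Finset.range n, c i) * f n := by
    intro n
    induction n with
    | zero => simp
    | succ n ih => rw [Finset.prod_range_succ, mul_assoc, ← h, ih]
  exact tendsto_nhds_unique (tendsto_const_nhds.congr h0) (hc.mul hf)

section
variable {q : ℂ} (hq : ‖q‖ < 1)
include hq

theorem tendsto_tsum_lebesgueCoeff_mul_pow {b : ℂ} (hb : ‖b‖ ≤ 1) :
    Tendsto (fun k : ℕ => ∑' n, lebesgueCoeff q b n * (q ^ k) ^ n) atTop (𝓝 1) := by
  have h0 : ∑' n, lebesgueCoeff q b n * 0 ^ n = 1 := by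
    rw [tsum_eq_single 0 fun n hn => by simp [hn]]
    simp [lebesgueCoeff]
  rw [← h0]
  refine tendsto_tsum_of_dominated_convergence (summable_lebesgueBound hq) (fun n => ?_)
    (Eventually.of_forall fun k n => ?_)
  · exact ((tendsto_pow_atTop_nhds_zero_of_norm_lt_one hq).pow _).const_mul _
  · rw [norm_mul, norm_pow, norm_pow]
    exact (mul_le_of_le_one_right (norm_nonneg _) (pow_le_one₀ (by positivity)
      (pow_le_one₀ (norm_nonneg q) hq.le))).trans (norm_lebesgueCoeff_le hq hb n)

/-- At `b = 0` the recurrence in `x` is first order, F(x) = (1 + xq) F(xq), and iterates to Euler's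
product. -/
theorem tsum_lebesgueCoeff_zero : ∑' n, lebesgueCoeff q 0 n = qPochInf (-q) q := by
  have h := eq_mul_of_tendsto (f := fun k : ℕ => ∑' n, lebesgueCoeff q 0 n * (q ^ k) ^ n)
    (c := fun k => 1 - -q * q ^ k) (fun k => ?_)
    (tendsto_tsum_lebesgueCoeff_mul_pow hq (by simp)) (tendsto_qPoch (-q) hq)
  · simpa using h
  · have := tsum_lebesgueCoeff_mul_sub hq (b := 0) (x := q ^ k) (by simp)
      (by rw [norm_pow]; exact pow_le_one₀ (norm_nonneg q) hq.le)
    simp only [← pow_succ] at this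
    linear_combination this

/-- The case `a = 1 / q` of Lebesgue's identity. -/
theorem tsum_lebesgueCoeff_one :
    ∑' n, lebesgueCoeff q 1 n = qPochInf (-q) (q ^ 2) * qPochInf (-q) q := by
  have hq2 : ‖q ^ 2‖ < 1 := by rw [norm_pow]; exact pow_lt_one₀ (norm_nonneg q) hq two_ne_zero
  have hb : ∀ k : ℕ, ‖(q ^ 2) ^ k‖ ≤ 1 := fun k => by
    rw [norm_pow]; exact pow_le_one₀ (norm_nonneg _) hq2.le
  -- Iterate along b = q^(2k), which tends to 0, where Euler's product gives the remaining factor.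
  have h := eq_mul_of_tendsto (f := fun k : ℕ => ∑' n, lebesgueCoeff q ((q ^ 2) ^ k) n)
    (c := fun k => 1 - -q * (q ^ 2) ^ k) (l := ∑' n, lebesgueCoeff q 0 n) (fun k => ?_) ?_
    (tendsto_qPoch (-q) hq2)
  · simpa [tsum_lebesgueCoeff_zero hq] using h
  · have e : (q ^ 2) ^ k * q * q = (q ^ 2) ^ (k + 1) := by ring
    have := tsum_lebesgueCoeff_eq hq (hb k)
    rw [e] at this
    rw [this]
    ring
  · refine tendsto_tsum_of_dominated_convergence (summable_lebesgueBound hq) (fun n => ?_)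
      (Eventually.of_forall fun k n => norm_lebesgueCoeff_le hq (hb k) n)
    refine tendsto_finsetProd _ fun i _ => ?_
    exact ((((tendsto_pow_atTop_nhds_zero_of_norm_lt_one hq2).mul_const _).const_add _).const_mul
      _).div_const _

/-- The maximum M of two consecutive norms satisfies M k ≤ (1 + 2|q|^(k+1)) M (k + 1). The product
of these factors converges and M tends to 0, so M 0 = 0. -/
theorem eq_zero_of_recurrence {d : ℕ → ℂ} (hd : Tendsto d atTop (𝓝 0))
    (h : ∀ k, d k = (1 + q ^ (k + 1)) * d (k + 1) + q ^ (k + 1) * d (k + 2)) : d 0 = 0 := by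
  let M : ℕ → ℝ := fun k => max ‖d k‖ ‖d (k + 1)‖
  have hM : ∀ k, M k ≤ (1 + 2 * ‖q‖ ^ (k + 1)) * M (k + 1) := by
    intro k
    have h1 : ‖d (k + 1)‖ ≤ M (k + 1) := le_max_left _ _
    have h2 : ‖d (k + 2)‖ ≤ M (k + 1) := le_max_right _ _
    have h0 : 0 ≤ M (k + 1) := (norm_nonneg _).trans h1
    refine max_le ?_ ?_
    · rw [h k]
      calc _ ≤ ‖(1 + q ^ (k + 1)) * d (k + 1)‖ + ‖q ^ (k + 1) * d (k + 2)‖ := norm_add_le _ _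
        _ ≤ (1 + ‖q‖ ^ (k + 1)) * M (k + 1) + ‖q‖ ^ (k + 1) * M (k + 1) := by
          rw [norm_mul, norm_mul, norm_pow]
          gcongr
          exact (norm_add_le _ _).trans (by simp)
        _ = _ := by ring
    · exact h1.trans (le_mul_of_one_le_left h0 (by
        have : 0 ≤ ‖q‖ ^ (k + 1) := by positivity
        linarith))
  have hprod : ∀ n, M 0 ≤ (∏ i ∈ Finset.range n, (1 + 2 * ‖q‖ ^ (i + 1))) * M n := by
    intro n
    induction n with
    | zero => simp
    | succ n ih =>
      rw [Finset.prod_range_succ, mul_assoc]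
      exact ih.trans (mul_le_mul_of_nonneg_left (hM n) (Finset.prod_nonneg fun i _ => by positivity))
  have hs : Summable fun i : ℕ => ‖2 * ‖q‖ ^ (i + 1)‖ := by
    refine (((summable_geometric_of_lt_one (norm_nonneg q) hq).mul_left (2 * ‖q‖))).congr fun i => ?_
    rw [Real.norm_of_nonneg (by positivity)]
    ring
  have ht := (multipliable_one_add_of_summable hs).hasProd.tendsto_prod_nat
  have hM0 : Tendsto M atTop (𝓝 0) := by
    simpa using (tendsto_norm_zero.comp hd).max
      ((tendsto_norm_zero.comp hd).comp (tendsto_add_atTop_nat 1))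
  have hle : M 0 ≤ 0 := by
    simpa using ge_of_tendsto' (ht.mul hM0) hprod
  exact norm_le_zero_iff.mp ((le_max_left _ _).trans hle)

theorem genFun_one_eq_lebesgue :
    TwoColoredRR.genFun 1 q 1 = qPochInf (-q) (q ^ 2) * qPochInf (-q) q := by
  have h := eq_zero_of_recurrence hq (d := fun k => TwoColoredRR.genFun 1 q (q ^ k) -
    ∑' n, lebesgueCoeff q 1 n * (q ^ k) ^ n) ?_ fun k => ?_
  · simp only [pow_zero, one_pow, mul_one, sub_eq_zero] at h
    rw [h, tsum_lebesgueCoeff_one hq]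
  · simpa using (TwoColoredRR.tendsto_genFun_pow hq).sub
      (tendsto_tsum_lebesgueCoeff_mul_pow hq (b := 1) (by simp))
  · have h1 := TwoColoredRR.genFun_one_sub_two hq (q ^ k)
    have h2 := tsum_lebesgueCoeff_mul_sub hq (b := 1) (x := q ^ k) (by simp)
      (by rw [norm_pow]; exact pow_le_one₀ (norm_nonneg q) hq.le)
    simp only [TwoColoredRR.genFun_two_eq hq, ← pow_succ] at h1 h2
    linear_combination h1 - h2

end

/-! ### Infinite product identities -/

theorem qPoch_mul_qPoch_neg (a q : ℂ) (n : ℕ) :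
    qPoch a q n * qPoch (-a) q n = qPoch (a ^ 2) (q ^ 2) n := by
  simp only [qPoch, ← Finset.prod_mul_distrib]
  refine Finset.prod_congr rfl fun i _ => ?_
  rw [← pow_mul, mul_comm 2 i, pow_mul]
  ring

theorem qPoch_two_mul (a q : ℂ) (n : ℕ) :
    qPoch a q (2 * n) = qPoch a (q ^ 2) n * qPoch (a * q) (q ^ 2) n := by
  induction n with
  | zero => simp [qPoch]
  | succ n ih =>
    simp only [qPoch] at ih ⊢
    rw [Nat.mul_succ, Finset.prod_range_succ, Finset.prod_range_succ, ih, Finset.prod_range_succ,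
      Finset.prod_range_succ, pow_succ, pow_mul]
    ring

theorem norm_sq_lt_one {q : ℂ} (hq : ‖q‖ < 1) : ‖q ^ 2‖ < 1 := by
  rw [norm_pow]; exact pow_lt_one₀ (norm_nonneg q) hq two_ne_zero

section
variable {q : ℂ} (hq : ‖q‖ < 1)
include hq

theorem qPochInf_mul_qPochInf_neg (a : ℂ) :
    qPochInf a q * qPochInf (-a) q = qPochInf (a ^ 2) (q ^ 2) :=
  tendsto_nhds_unique (((tendsto_qPoch a hq).mul (tendsto_qPoch (-a) hq)).congr
    fun n => qPoch_mul_qPoch_neg a q n) (tendsto_qPoch (a ^ 2) (norm_sq_lt_one hq))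

theorem qPochInf_eq_mul_sq (a : ℂ) :
    qPochInf a q = qPochInf a (q ^ 2) * qPochInf (a * q) (q ^ 2) :=
  tendsto_nhds_unique ((tendsto_qPoch a hq).comp
      (tendsto_id.const_mul_atTop' (show 0 < 2 by norm_num)))
    (((tendsto_qPoch a (norm_sq_lt_one hq)).mul (tendsto_qPoch (a * q) (norm_sq_lt_one hq))).congr
      fun n => (qPoch_two_mul a q n).symm)

theorem qPochInf_neg_self_ne_zero : qPochInf (-q) q ≠ 0 := by
  have h := qPochInf_self_ne_zero (norm_sq_lt_one hq)
  rw [← qPochInf_mul_qPochInf_neg hq] at h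
  exact right_ne_zero_of_mul h

end

/-! ### Gauss's identity -/

/-- `(q; q)_n / (-q; q)_n`. -/
noncomputable def gaussProd (q : ℂ) (n : ℕ) : ℂ :=
  ∏ i ∈ Finset.range n, (1 - q ^ (i + 1)) / (1 + q ^ (i + 1))

/-- The coefficient `2 (-1) ^ s (-q; q)_s / ((1 + q ^ s) (q; q)_s)` in the finite form of Gauss's
identity. -/
noncomputable def gaussCoeff (q : ℂ) (s : ℕ) : ℂ := (-1) ^ s * 2 / ((1 + q ^ s) * gaussProd q s)

section
variable {q : ℂ} (hq : ‖q‖ < 1)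
include hq

theorem one_add_pow_ne_zero' (n : ℕ) : 1 + q ^ n ≠ 0 := by
  cases n with
  | zero => norm_num
  | succ n => exact one_add_pow_ne_zero hq n

theorem gaussProd_ne_zero (n : ℕ) : gaussProd q n ≠ 0 :=
  Finset.prod_ne_zero_iff.mpr fun i _ =>
    div_ne_zero (one_sub_pow_ne_zero hq i) (one_add_pow_ne_zero hq i)

theorem tendsto_gaussProd :
    Tendsto (gaussProd q) atTop (𝓝 (qPochInf q q / qPochInf (-q) q)) := by
  refine ((tendsto_qPoch q hq).div (tendsto_qPoch (-q) hq) (qPochInf_neg_self_ne_zero hq)).congr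
    fun n => ?_
  simp only [qPoch, gaussProd, Pi.div_apply, ← Finset.prod_div_distrib]
  exact Finset.prod_congr rfl fun i _ => by ring

/-- Raising n changes each summand of the finite identity by a difference in s; the closed form
vanishes at `m = 0`, as 1 - q^m does. -/
theorem sum_gaussCoeff_sub (n m : ℕ) :
    ∑ s ∈ Finset.range m, gaussCoeff q s *
        (gaussProd q (n + 1) * (q ^ (n + 2)) ^ s - gaussProd q n * (q ^ (n + 1)) ^ s) =
      gaussCoeff q m * (q ^ (n + 1)) ^ m * (1 - q ^ m) / (1 + q ^ (n + 1)) * gaussProd q n := by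
  induction m with
  | zero => simp
  | succ m ih =>
    have h1 := one_add_pow_ne_zero hq n
    have h2 := one_add_pow_ne_zero' hq m
    have h3 := one_add_pow_ne_zero hq m
    have h4 := one_sub_pow_ne_zero hq m
    have h5 := gaussProd_ne_zero hq m
    have e1 : gaussProd q (n + 1) = gaussProd q n * ((1 - q ^ (n + 1)) / (1 + q ^ (n + 1))) :=
      Finset.prod_range_succ _ _
    have e2 : gaussProd q (m + 1) = gaussProd q m * ((1 - q ^ (m + 1)) / (1 + q ^ (m + 1))) :=
      Finset.prod_range_succ _ _
    have e3 : (q ^ (n + 2)) ^ m = (q ^ (n + 1)) ^ m * q ^ m := by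
      rw [← mul_pow, ← pow_succ]
    rw [Finset.sum_range_succ, ih, e1, e3, pow_succ (q ^ (n + 1)) m]
    simp only [gaussCoeff, e2, pow_succ (-1 : ℂ) m]
    -- The claim is now a rational identity in which these powers may be treated as independent
    -- variables.
    generalize q ^ (n + 1) = y at *
    generalize q ^ (m + 1) = z at *
    generalize q ^ m = w at *
    generalize gaussProd q n = P at *
    generalize gaussProd q m = Q at *
    field_simp
    ring

/-- A finite form of Gauss's identity. -/
theorem gaussProd_mul_sum (n : ℕ) :
    gaussProd q n * ∑ s ∈ Finset.range (n + 1), gaussCoeff q s * (q ^ (n + 1)) ^ s =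
      1 + 2 * ∑ j ∈ Finset.range n, (-1) ^ (j + 1) * q ^ (j + 1) ^ 2 := by
  induction n with
  | zero => simp [gaussProd, gaussCoeff]; norm_num
  | succ n ih =>
    rw [Finset.sum_range_succ _ n, mul_add, ← add_assoc, ← ih, Finset.sum_range_succ _ (n + 1)]
    have h := sum_gaussCoeff_sub hq n (n + 1)
    have h1 := one_add_pow_ne_zero hq n
    have h4 := one_sub_pow_ne_zero hq n
    have h5 := gaussProd_ne_zero hq n
    have e1 : gaussProd q (n + 1) = gaussProd q n * ((1 - q ^ (n + 1)) / (1 + q ^ (n + 1))) :=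
      Finset.prod_range_succ _ _
    -- The new summand s = n + 1 and the boundary term of the telescoped change together give the
    -- next theta term.
    have h0 : gaussProd q (n + 1) * (gaussCoeff q (n + 1) * (q ^ (n + 2)) ^ (n + 1)) +
        gaussCoeff q (n + 1) * (q ^ (n + 1)) ^ (n + 1) * (1 - q ^ (n + 1)) / (1 + q ^ (n + 1)) *
          gaussProd q n = 2 * ((-1) ^ (n + 1) * q ^ (n + 1) ^ 2) := by
      have e3 : (q ^ (n + 2)) ^ (n + 1) = (q ^ (n + 1)) ^ (n + 1) * q ^ (n + 1) := by
        rw [← mul_pow, ← pow_succ]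
      have e4 : q ^ (n + 1) ^ 2 = (q ^ (n + 1)) ^ (n + 1) := by rw [← pow_mul, sq]
      rw [e3, e4]
      simp only [gaussCoeff, e1]
      generalize (q ^ (n + 1)) ^ (n + 1) = x at *
      generalize q ^ (n + 1) = y at *
      field_simp
      ring
    simp only [mul_sub, Finset.sum_sub_distrib, mul_left_comm (gaussCoeff q _), ← Finset.mul_sum] at h
    linear_combination h0 + h

/-- The coefficients converge up to sign, hence are bounded by some C, and C |q|^s dominates. Only s
= 0, with coefficient 1, survives. -/
theorem tendsto_sum_gaussCoeff :
    Tendsto (fun n : ℕ => ∑ s ∈ Finset.range (n + 1), gaussCoeff q s * (q ^ (n + 1)) ^ s)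
      atTop (𝓝 1) := by
  have hlim : Tendsto (fun s => 2 / ((1 + q ^ s) * gaussProd q s)) atTop
      (𝓝 (2 / ((1 + 0) * (qPochInf q q / qPochInf (-q) q)))) := by
    refine tendsto_const_nhds.div (((tendsto_pow_atTop_nhds_zero_of_norm_lt_one hq).const_add
      1).mul (tendsto_gaussProd hq)) ?_
    rw [add_zero, one_mul]
    exact div_ne_zero (qPochInf_self_ne_zero hq) (qPochInf_neg_self_ne_zero hq)
  obtain ⟨C, hC⟩ := hlim.norm.bddAbove_range
  have hbd : ∀ s, ‖gaussCoeff q s‖ ≤ C := fun s => by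
    have := hC ⟨s, rfl⟩
    simpa [gaussCoeff] using this
  have h0 : ∑' s, gaussCoeff q s * 0 ^ s = 1 := by
    rw [tsum_eq_single 0 fun n hn => by simp [hn]]
    norm_num [gaussCoeff, gaussProd]
  have hsum : ∀ n : ℕ, ∑ s ∈ Finset.range (n + 1), gaussCoeff q s * (q ^ (n + 1)) ^ s =
      ∑' s, if s ∈ Finset.range (n + 1) then gaussCoeff q s * (q ^ (n + 1)) ^ s else 0 := fun n => by
    rw [tsum_eq_sum (s := Finset.range (n + 1)) fun s hs => if_neg hs]
    exact Finset.sum_congr rfl fun s hs => (if_pos hs).symm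
  simp only [hsum]
  rw [← h0]
  refine tendsto_tsum_of_dominated_convergence
    ((summable_geometric_of_lt_one (norm_nonneg q) hq).mul_left C) (fun s => ?_)
    (Eventually.of_forall fun n s => ?_)
  · have h1 : Tendsto (fun n : ℕ => gaussCoeff q s * (q ^ (n + 1)) ^ s) atTop
        (𝓝 (gaussCoeff q s * 0 ^ s)) :=
      (((tendsto_pow_atTop_nhds_zero_of_norm_lt_one hq).comp (tendsto_add_atTop_nat 1)).pow
        s).const_mul _
    refine h1.congr' ?_
    filter_upwards [eventually_ge_atTop s] with n hn
    rw [if_pos (Finset.mem_range.mpr (by omega))]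
  · have hC0 : 0 ≤ C := (norm_nonneg _).trans (hbd 0)
    split_ifs
    · rw [norm_mul, norm_pow, norm_pow]
      gcongr
      · exact hbd s
      · exact pow_le_of_le_one (norm_nonneg q) hq.le n.succ_ne_zero
    · rw [norm_zero]; positivity

theorem summable_gauss_nat : Summable fun n : ℕ => (-1 : ℂ) ^ (n + 1) * q ^ (n + 1) ^ 2 := by
  refine Summable.of_norm_bounded (summable_geometric_of_lt_one (norm_nonneg q) hq) fun n => ?_
  rw [norm_mul, norm_pow, norm_pow, norm_neg, norm_one, one_pow, one_mul]
  exact pow_le_pow_of_le_one (norm_nonneg q) hq.le (by nlinarith)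

/-- **Gauss's identity** for the alternating theta series. -/
theorem hasSum_gauss :
    HasSum (fun n : ℤ => (-1 : ℂ) ^ n * q ^ n ^ 2) (qPochInf q q / qPochInf (-q) q) := by
  have hs := (summable_gauss_nat hq).hasSum
  have h1 := ((tendsto_gaussProd hq).mul (tendsto_sum_gaussCoeff hq)).congr (gaussProd_mul_sum hq)
  have h2 := (hs.tendsto_sum_nat.const_mul 2).const_add 1
  have e := tendsto_nhds_unique h1 h2
  have e1 : ∀ n : ℕ, ((n : ℤ) + 1) = ((n + 1 : ℕ) : ℤ) := fun n => by push_cast; ring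
  -- Positive and negative indices contribute equally, which accounts for the factor 2 in the finite
  -- form.
  have := HasSum.of_add_one_of_neg_add_one (f := fun n : ℤ => (-1 : ℂ) ^ n * q ^ n ^ 2)
    (m := ∑' n : ℕ, (-1 : ℂ) ^ (n + 1) * q ^ (n + 1) ^ 2)
    (m' := ∑' n : ℕ, (-1 : ℂ) ^ (n + 1) * q ^ (n + 1) ^ 2) 
    (by convert hs using 2 with n; rw [e1]; norm_cast)
    (by convert hs using 2 with n; rw [e1, even_two.neg_pow, zpow_neg, ← inv_zpow, inv_neg_one]; norm_cast)
  convert this using 1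
  rw [mul_one] at e
  rw [e]
  simp
  ring

end

/-! ### Assembly -/

theorem theorem1p2 (q : ℂ) (hq : ‖q‖ < 1) :
    HasSum (fun n : ℕ => (TwoColoredRR.count n : ℂ) * q ^ n)
      (qPochInf (-q) q * qPochInfList [q ^ 2, q ^ 2, q ^ 4] (q ^ 4) / qPochInf q q) ∧
    (∀ x : ℂ, ∀ j ∈ ({1, 2} : Set ℕ), Summable fun p : ℕ × ℕ =>
      (TwoColoredRR.countGE j p.1 p.2 : ℂ) * x ^ p.1 * q ^ p.2) ∧
    (∀ x : ℂ, TwoColoredRR.genFun 1 q x - TwoColoredRR.genFun 2 q x =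
      x * q * (TwoColoredRR.genFun 1 q (x * q) + TwoColoredRR.genFun 2 q (x * q))) ∧
    (∀ x : ℂ, TwoColoredRR.genFun 2 q x = TwoColoredRR.genFun 1 q (x * q)) ∧
    TwoColoredRR.genFun 1 q 1 =
      qPochInf (-q) q * qPochInfList [q ^ 2, q ^ 2, q ^ 4] (q ^ 4) / qPochInf q q ∧
    (Summable fun n : ℤ => (-1 : ℂ) ^ n * q ^ (2 * n ^ 2)) ∧
    TwoColoredRR.genFun 1 q 1 =
      qPochInf (-q) q / qPochInf q q * ∑' n : ℤ, (-1 : ℂ) ^ n * q ^ (2 * n ^ 2) := by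
  have hq2 := norm_sq_lt_one hq
  have h0 := qPochInf_self_ne_zero hq
  have hsplit := qPochInf_eq_mul_sq hq2 (q ^ 2)
  have e4 : (q ^ 2) ^ 2 = q ^ 4 := by ring
  have e4' : q ^ 2 * q ^ 2 = q ^ 4 := by ring
  have eq2 : q * q = q ^ 2 := by ring
  rw [e4, e4'] at hsplit
  have hodd := qPochInf_mul_qPochInf_neg hq2 q
  rw [e4] at hodd
  have hself := qPochInf_eq_mul_sq hq q
  rw [eq2] at hself
  have hneg := qPochInf_mul_qPochInf_neg hq2 (q ^ 2)
  rw [e4] at hneg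
  have hlist : qPochInfList [q ^ 2, q ^ 2, q ^ 4] (q ^ 4) =
      qPochInf (q ^ 2) (q ^ 4) * (qPochInf (q ^ 2) (q ^ 4) * qPochInf (q ^ 4) (q ^ 4)) := by
    simp [qPochInfList]
  -- Multiplying by (q; q)_∞ = (q; q²)_∞ (q²; q²)_∞ pairs (q; q²)_∞ with (-q; q²)_∞ into (q²; q⁴)_∞,
  -- and (q²; q²)_∞ splits as (q²; q⁴)_∞ (q⁴; q⁴)_∞.
  have hprod : TwoColoredRR.genFun 1 q 1 =
      qPochInf (-q) q * qPochInfList [q ^ 2, q ^ 2, q ^ 4] (q ^ 4) / qPochInf q q := by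
    rw [genFun_one_eq_lebesgue hq, hlist, ← hsplit, ← hodd, eq_div_iff h0, hself]
    ring
  have hgauss : HasSum (fun n : ℤ => (-1 : ℂ) ^ n * q ^ (2 * n ^ 2))
      (qPochInfList [q ^ 2, q ^ 2, q ^ 4] (q ^ 4)) := by
    have h := hasSum_gauss hq2
    have e : qPochInf (q ^ 2) (q ^ 2) / qPochInf (-q ^ 2) (q ^ 2) =
        qPochInfList [q ^ 2, q ^ 2, q ^ 4] (q ^ 4) := by
      rw [div_eq_iff (qPochInf_neg_self_ne_zero hq2), hlist]
      linear_combination hsplit - qPochInf (q ^ 2) (q ^ 4) * hneg +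
        qPochInf (q ^ 2) (q ^ 4) * qPochInf (-q ^ 2) (q ^ 2) * hsplit
    rw [e] at h
    convert h using 3 with n
    rw [zpow_mul]
    norm_cast
  refine ⟨hprod ▸ TwoColoredRR.hasSum_count hq, fun x j _ =>
    (TwoColoredRR.hasSum_countGE hq j x).summable, TwoColoredRR.genFun_one_sub_two hq,
    TwoColoredRR.genFun_two_eq hq, hprod, hgauss.summable, ?_⟩
  rw [hgauss.tsum_eq, hprod]
  ring
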